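/- Let $\mathfrak g$ be a finite-dimensional real semisimple Lie algebra with Killing form $\kappa$, and let $\mathfrak g=\mathfrak g_0\oplus\mathfrak m$ be a Cartan decomposition: $[\mathfrak g_0,\mathfrak g_0]\subset\mathfrak g_0$, $[\mathfrak g_0,\mathfrak m]\subset\mathfrak m$, $[\mathfrak m,\mathfrak m]\subset\mathfrak g_0$, $\kappa(\mathfrak g_0,\mathfrak m)=0$, and $\kappa$ is negative definite on $\mathfrak g_0$ and positive definite on $\mathfrak m$. Let $\mathfrak a\subset\mathfrak m$ be a maximal abelian subspace and $n=\dim\mathfrak a$. Let $\mathfrak b=\mathfrak a^\perp$ be the $\kappa$-orthogonal complement of $\mathfrak a$ in $\mathfrak m$, let $\mathfrak g_{\mathfrak a}=\{X\in\mathfrak g_0: [X,\mathfrak a]=0\}$, and let $\mathfrak p$ be the $\kappa$-orthogonal complement of $\mathfrak g_{\mathfrak a}$ in $\mathfrak g_0$. The map $B\mapsto \mathrm{ad}_B|_{\mathfrak a}$ is an injection $\mathfrak b\to\mathrm{Hom}(\mathfrak a,\mathfrak p)$; let $\mathbf A\subset \mathrm{Hom}(\mathfrak a,\mathfrak p)$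 be its image, which is thereby identified with $\mathfrak b$. For $B\in\mathfrak b$ let $\Phi|_B\in\mathfrak p\otimes\Lambda^2\mathfrak a^*$ be given by $\Phi|_B(A_1,A_2)=[[A_1,B],[A_2,B]]$, and regard $\Phi$ as a map on $M=\mathfrak a\oplus\mathbf A$ that does not depend on the component in $\mathfrak a$. We use the following notions. For a subspace $\mathfrak c\subset\mathfrak a$ put $\mathrm{Ker}(\mathbf A,\mathfrak c)=\{Q\in\mathbf A: Q|_{\mathfrak c}=0\}$. A flag $0\subset\mathfrak a_1\subset\dots\subset\mathfrak a_n=\mathfrak a$ with $\dim\mathfrak a_h=h$ is generic if each $\dim\mathrm{Ker}(\mathbf A,\mathfrak a_h)$ is minimal among all $h$-dimensional subspaces of $\mathfrak a$. The characters $s_1,\dots,s_n$ of $\mathbf A$ are defined by $s_1+\dots+s_j=\dim\mathbf A-\dim\mathrm{Ker}(\mathbf A,\mathfrak a_j)$ for a generic flag. The first prolongation $\mathbf A^{(1)}$ is the space of linear maps $Q:\mathfrak a\to\mathbf A$ with $Q(X)(Y)=Q(Y)(X)$ for all $X,Y\in\mathfrak a$. The tableau $\mathbf A$ is involutive if $\dim\mathbf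 A^{(1)}=s_1+2s_2+\dots+ns_n$. The space $B^{0,2}(\mathbf A)\subset\mathfrak p\otimes\Lambda^2\mathfrak a^*$ is the image of $\delta:\mathrm{Hom}(\mathfrak a,\mathbf A)\to\mathfrak p\otimes\Lambda^2\mathfrak a^*$, $(\delta\phi)(X_1,X_2)=\phi(X_2)(X_1)-\phi(X_1)(X_2)$. Then: 1. $\mathbf A$ is involutive. 2. The characters of $\mathbf A$ are $s_1=\dim\mathfrak b$ and $s_j=0$ for $2\le j\le n$. 3. The map $\mathfrak p\to\mathbf A^{(1)}$ that sends $X$ to $A_1\mapsto \mathrm{ad}_{[X,A_1]}|_{\mathfrak a}$ is a linear isomorphism. 4. $\Phi|_B\in B^{0,2}(\mathbf A)$ for every $B\in\mathfrak b$. 5. $\Phi$ satisfies the torsion condition: $\Phi$ is differentiable, and for all $m\in M$, $Q\in\mathbf A^{(1)}$ and $A_1,A_2,A_3\in\mathfrak a$, the sum over the cyclic permutations of $(1,2,3)$ $$\sum_{(1,2,3)}\Phi_*|_m\bigl(A_1+Q(A_1)\bigr)(A_2,A_3)=0,$$ where $\Phi_*|_m$ is the differential of $\Phi$ at $m$. 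-/

import Mathlib

/-! ### Tableaux -/

namespace Tableau

section Algebra

variable {K V W : Type*} [Field K] [AddCommGroup V] [Module K V] [AddCommGroup W] [Module K W]

/-- `Ker(A, U)`: the elements of the tableau `A ⊆ Hom(V, W)` that vanish on the subspace `U`. -/
def kerOn (A : Submodule K (V →ₗ[K] W)) (U : Submodule K V) : Submodule K (V →ₗ[K] W) where
  carrier := {Q | Q ∈ A ∧ ∀ x ∈ U, Q x = 0}
  zero_mem' := ⟨A.zero_mem, fun _ _ => rfl⟩
  add_mem' := fun {P Q} hP hQ => ⟨A.add_mem hP.1 hQ.1, fun x hx => by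
    rw [LinearMap.add_apply, hP.2 x hx, hQ.2 x hx, add_zero]⟩
  smul_mem' := fun c Q hQ => ⟨A.smul_mem c hQ.1, fun x hx => by
    rw [LinearMap.smul_apply, hQ.2 x hx, smul_zero]⟩

/-- A subspace `U` is generic for `A` if `dim Ker(A, U)` is minimal among all subspaces of the
same dimension. -/
def IsGeneric (A : Submodule K (V →ₗ[K] W)) (U : Submodule K V) : Prop :=
  ∀ U' : Submodule K V, Module.finrank K U' = Module.finrank K U →
    Module.finrank K (kerOn A U) ≤ Module.finrank K (kerOn A U')

/-- A generic flag `0 = F 0 ⊂ F 1 ⊂ ⋯ ⊂ F n = V`, where `n = dim V`. The flag is indexed by `ℕ`;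
monotonicity forces `F h = V` for `h ≥ n`. -/
structure IsGenericFlag (A : Submodule K (V →ₗ[K] W)) (F : ℕ → Submodule K V) : Prop where
  mono : Monotone F
  finrank_eq : ∀ h ≤ Module.finrank K V, Module.finrank K (F h) = h
  generic : ∀ h, 1 ≤ h → h ≤ Module.finrank K V → IsGeneric A (F h)

/-- `s 1, …, s n` are the characters of the tableau `A`: there is a generic flag, and for every
generic flag `F` and `1 ≤ j ≤ n`, `s 1 + ⋯ + s j` is the codimension of `Ker(A, F j)` in `A`
(written additively). -/
def HasCharacters (A : Submodule K (V →ₗ[K] W)) (s : ℕ → ℕ) : Prop :=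
  (∃ F, IsGenericFlag A F) ∧
    ∀ F, IsGenericFlag A F → ∀ j, 1 ≤ j → j ≤ Module.finrank K V →
      (∑ i ∈ Finset.Icc 1 j, s i) + Module.finrank K (kerOn A (F j)) = Module.finrank K A

/-- The first prolongation `A⁽¹⁾ ⊆ Hom(V, A)`. -/
def prolongation (A : Submodule K (V →ₗ[K] W)) : Submodule K (V →ₗ[K] A) where
  carrier := {Q | ∀ X Y : V, (Q X : V →ₗ[K] W) Y = (Q Y : V →ₗ[K] W) X}
  zero_mem' := fun _ _ => rfl
  add_mem' := fun {P Q} hP hQ X Y => by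
    simp only [LinearMap.add_apply, Submodule.coe_add, hP X Y, hQ X Y]
  smul_mem' := fun c Q hQ X Y => by
    simp only [LinearMap.smul_apply, Submodule.coe_smul, hQ X Y]

/-- `A` is involutive: `dim A⁽¹⁾ = s₁ + 2 s₂ + ⋯ + n sₙ`, where `s₁, …, sₙ` are the characters. -/
def IsInvolutive (A : Submodule K (V →ₗ[K] W)) : Prop :=
  ∃ s : ℕ → ℕ, HasCharacters A s ∧
    Module.finrank K (prolongation A) = ∑ j ∈ Finset.Icc 1 (Module.finrank K V), j * s j

/-- The `W`-valued `2`-form on `V` given by an alternating bilinear map. -/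
def twoForm (β : V →ₗ[K] V →ₗ[K] W) (h : ∀ x, β x x = 0) : V [⋀^Fin 2]→ₗ[K] W where
  toFun v := β (v 0) (v 1)
  map_update_add' := by
    intro inst v i x y
    rw [Subsingleton.elim inst (instDecidableEqFin 2)]
    fin_cases i <;> simp
  map_update_smul' := by
    intro inst v i c x
    rw [Subsingleton.elim inst (instDecidableEqFin 2)]
    fin_cases i <;> simp
  map_eq_zero_of_eq' := by
    intro v i j hv hij
    have h01 : v 0 = v 1 := by
      fin_cases i <;> fin_cases j <;> simp_all
    rw [h01]
    exact h _

/-- The Spencer differential `δ^{1,1} : C^{1,1}(A) = Hom(V, A) → C^{0,2}(A) = W ⊗ Λ²V*`,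
`(δφ)(X₁, X₂) = φ(X₂)(X₁) - φ(X₁)(X₂)`. -/
def spencerDelta (A : Submodule K (V →ₗ[K] W)) : (V →ₗ[K] A) →ₗ[K] V [⋀^Fin 2]→ₗ[K] W where
  toFun φ := twoForm ((A.subtype ∘ₗ φ).flip - A.subtype ∘ₗ φ) (fun x => by simp)
  map_add' := fun φ ψ => by
    ext v
    simp [twoForm]
    abel
  map_smul' := fun c φ => by
    ext v
    simp [twoForm, smul_sub]

/-- `B^{0,2}(A)`, the space of Spencer coboundaries in `C^{0,2}(A) = W ⊗ Λ²V*`. -/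
def B02 (A : Submodule K (V →ₗ[K] W)) : Submodule K (V [⋀^Fin 2]→ₗ[K] W) :=
  LinearMap.range (spencerDelta A)

end Algebra

section Torsion

instance finiteDimensional_twoForms {V W : Type*} [AddCommGroup V] [Module ℝ V]
    [FiniteDimensional ℝ V] [AddCommGroup W] [Module ℝ W] [FiniteDimensional ℝ W] :
    FiniteDimensional ℝ (V [⋀^Fin 2]→ₗ[ℝ] W) :=
  Module.Finite.of_injective
    (AlternatingMap.toMultilinearMapLM : (V [⋀^Fin 2]→ₗ[ℝ] W) →ₗ[ℝ] _)
    AlternatingMap.coe_multilinearMap_injective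

/-- `L` is the (Fréchet) differential at `m` of the map `f` between finite-dimensional real vector
spaces: it is so in linear coordinates. (The choice of the bases is immaterial.) -/
def HasDifferentialAt {E F : Type*} [AddCommGroup E] [Module ℝ E] [FiniteDimensional ℝ E]
    [AddCommGroup F] [Module ℝ F] [FiniteDimensional ℝ F]
    (f : E → F) (L : E →ₗ[ℝ] F) (m : E) : Prop :=
  HasFDerivAt
    (fun x => (Module.finBasis ℝ F).equivFun (f ((Module.finBasis ℝ E).equivFun.symm x)))
    (LinearMap.toContinuousLinearMap
      ((Module.finBasis ℝ F).equivFun.toLinearMap ∘ₗ L ∘ₗ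
        (Module.finBasis ℝ E).equivFun.symm.toLinearMap))
    ((Module.finBasis ℝ E).equivFun m)

variable {V W : Type*} [AddCommGroup V] [Module ℝ V] [FiniteDimensional ℝ V]
  [AddCommGroup W] [Module ℝ W] [FiniteDimensional ℝ W]

/-- The torsion condition for `Φ : M = V ⊕ A → C^{0,2}(A)`: `Φ` is differentiable, and
`∑_{cyclic} Φ_*|_{m} (A₁ + Q(A₁)) (A₂, A₃) = 0` for `m ∈ M`, `Q ∈ A⁽¹⁾` and `A₁, A₂, A₃ ∈ V`. -/
def TorsionCondition (A : Submodule ℝ (V →ₗ[ℝ] W)) (Φ : V × A → V [⋀^Fin 2]→ₗ[ℝ] W) : Prop :=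
  ∀ m : V × A, ∃ L : V × A →ₗ[ℝ] V [⋀^Fin 2]→ₗ[ℝ] W, HasDifferentialAt Φ L m ∧
    ∀ Q ∈ prolongation A, ∀ A₁ A₂ A₃ : V,
      L (A₁, Q A₁) ![A₂, A₃] + L (A₂, Q A₂) ![A₃, A₁] + L (A₃, Q A₃) ![A₁, A₂] = 0

end Torsion

end Tableau

/-! ### The tableau of a Cartan decomposition -/

namespace Cartan

variable {g : Type*} [LieRing g] [LieAlgebra ℝ g]

/-- `g = g₀ ⊕ m` is a Cartan decomposition of the real Lie algebra `g`. -/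
structure IsCartanDecomposition (g₀ m : Submodule ℝ g) : Prop where
  isCompl : IsCompl g₀ m
  lie_g₀_g₀ : ∀ x ∈ g₀, ∀ y ∈ g₀, ⁅x, y⁆ ∈ g₀
  lie_g₀_m : ∀ x ∈ g₀, ∀ y ∈ m, ⁅x, y⁆ ∈ m
  lie_m_m : ∀ x ∈ m, ∀ y ∈ m, ⁅x, y⁆ ∈ g₀
  orthogonal : ∀ x ∈ g₀, ∀ y ∈ m, killingForm ℝ g x y = 0
  neg_def : ∀ x ∈ g₀, x ≠ 0 → killingForm ℝ g x x < 0
  pos_def : ∀ x ∈ m, x ≠ 0 → 0 < killingForm ℝ g x x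

/-- `a` is a maximal abelian subspace of `m`. -/
def IsMaximalAbelian (m a : Submodule ℝ g) : Prop :=
  Maximal (fun s : Submodule ℝ g => s ≤ m ∧ ∀ x ∈ s, ∀ y ∈ s, ⁅x, y⁆ = 0) a

/-- The orthogonal complement, with respect to the Killing form, of `s` inside `t`. -/
def orthIn (t s : Submodule ℝ g) : Submodule ℝ g where
  carrier := {x | x ∈ t ∧ ∀ y ∈ s, killingForm ℝ g x y = 0}
  zero_mem' := ⟨t.zero_mem, fun y _ => by simp⟩
  add_mem' := fun {u v} hu hv => ⟨t.add_mem hu.1 hv.1, fun y hy => by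
    simp [hu.2 y hy, hv.2 y hy]⟩
  smul_mem' := fun c u hu => ⟨t.smul_mem c hu.1, fun y hy => by simp [hu.2 y hy]⟩

/-- The centralizer `g_a = {X ∈ g₀ : [X, a] = 0}` of `a` in `g₀`. -/
def centralizerIn (g₀ a : Submodule ℝ g) : Submodule ℝ g where
  carrier := {x | x ∈ g₀ ∧ ∀ y ∈ a, ⁅x, y⁆ = 0}
  zero_mem' := ⟨g₀.zero_mem, fun y _ => zero_lie y⟩
  add_mem' := fun {u v} hu hv => ⟨g₀.add_mem hu.1 hv.1, fun y hy => by
    rw [add_lie, hu.2 y hy, hv.2 y hy, add_zero]⟩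
  smul_mem' := fun c u hu => ⟨g₀.smul_mem c hu.1, fun y hy => by
    rw [smul_lie, hu.2 y hy, smul_zero]⟩

/-- `b = a^⊥`, the orthogonal complement of `a` in `m`. -/
abbrev bSpace (m a : Submodule ℝ g) : Submodule ℝ g := orthIn m a

/-- `p`, the orthogonal complement of the centralizer `g_a` in `g₀`. -/
abbrev pSpace (g₀ a : Submodule ℝ g) : Submodule ℝ g := orthIn g₀ (centralizerIn g₀ a)

variable {g₀ m a : Submodule ℝ g}

theorem killing_assoc (x y z : g) : killingForm ℝ g ⁅x, y⁆ z = killingForm ℝ g x ⁅y, z⁆ :=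
  LieModule.traceForm_apply_lie_apply ℝ g g x y z

theorem killing_symm (x y : g) : killingForm ℝ g x y = killingForm ℝ g y x :=
  LieModule.traceForm_comm ℝ g g x y

theorem lie_mem_pSpace (hD : IsCartanDecomposition g₀ m) (ha : IsMaximalAbelian m a)
    {x y : g} (hx : x ∈ bSpace m a) (hy : y ∈ a) : ⁅x, y⁆ ∈ pSpace g₀ a := by
  refine ⟨hD.lie_m_m x hx.1 y (ha.prop.1 hy), fun z hz => ?_⟩
  rw [killing_assoc, ← lie_skew, hz.2 y hy]
  simp

/-- The map `b → Hom(a, p)`, `B ↦ ad_B|_a`. -/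
def adMap (hD : IsCartanDecomposition g₀ m) (ha : IsMaximalAbelian m a) :
    bSpace m a →ₗ[ℝ] a →ₗ[ℝ] pSpace g₀ a :=
  LinearMap.mk₂ ℝ (fun x y => ⟨⁅(x : g), (y : g)⁆, lie_mem_pSpace hD ha x.2 y.2⟩)
    (fun x x' y => Subtype.ext (by simp))
    (fun c x y => Subtype.ext (by simp))
    (fun x y y' => Subtype.ext (by simp))
    (fun c x y => Subtype.ext (by simp))

theorem adMap_injective (hD : IsCartanDecomposition g₀ m) (ha : IsMaximalAbelian m a) :
    Function.Injective (adMap hD ha) := by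
  rw [injective_iff_map_eq_zero]
  intro x hx
  have hxa : ∀ y ∈ a, ⁅(x : g), y⁆ = 0 := fun y hy =>
    congrArg Subtype.val (LinearMap.congr_fun hx ⟨y, hy⟩)
  have hmem : (x : g) ∈ a := by
    have hle : a ⊔ Submodule.span ℝ {(x : g)} ≤ a := by
      refine ha.le_of_ge ⟨sup_le ha.prop.1 ?_, ?_⟩ le_sup_left
      · rw [Submodule.span_singleton_le_iff_mem]
        exact x.2.1
      · intro u hu v hv
        obtain ⟨u₁, hu₁, u₂, hu₂, rfl⟩ := Submodule.mem_sup.1 hu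
        obtain ⟨v₁, hv₁, v₂, hv₂, rfl⟩ := Submodule.mem_sup.1 hv
        obtain ⟨c, rfl⟩ := Submodule.mem_span_singleton.1 hu₂
        obtain ⟨d, rfl⟩ := Submodule.mem_span_singleton.1 hv₂
        have h1 : ⁅u₁, (x : g)⁆ = 0 := by rw [← lie_skew, hxa u₁ hu₁, neg_zero]
        simp [ha.prop.2 u₁ hu₁ v₁ hv₁, hxa v₁ hv₁, h1]
    exact hle (Submodule.mem_sup_right (Submodule.mem_span_singleton_self _))
  by_contra hne
  have hpos := hD.pos_def x x.2.1 (fun h => hne (Subtype.ext h))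
  rw [x.2.2 x hmem] at hpos
  exact lt_irrefl _ hpos

/-- The tableau `A ⊆ Hom(a, p)` that realizes `b`, i.e. `A = {ad_B|_a : B ∈ b}`. -/
def tableau (hD : IsCartanDecomposition g₀ m) (ha : IsMaximalAbelian m a) :
    Submodule ℝ (a →ₗ[ℝ] pSpace g₀ a) :=
  LinearMap.range (adMap hD ha)

/-- The identification `b ≃ A`, `B ↦ ad_B|_a`. -/
noncomputable def bEquiv (hD : IsCartanDecomposition g₀ m) (ha : IsMaximalAbelian m a) :
    bSpace m a ≃ₗ[ℝ] tableau hD ha :=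
  LinearEquiv.ofInjective (adMap hD ha) (adMap_injective hD ha)

theorem lie_lie_mem_pSpace (hD : IsCartanDecomposition g₀ m) (ha : IsMaximalAbelian m a)
    {B x y : g} (hB : B ∈ bSpace m a) (hx : x ∈ a) (hy : y ∈ a) :
    ⁅⁅x, B⁆, ⁅y, B⁆⁆ ∈ pSpace g₀ a := by
  have hxm := ha.prop.1 hx
  have hym := ha.prop.1 hy
  refine ⟨hD.lie_g₀_g₀ _ (hD.lie_m_m x hxm B hB.1) _ (hD.lie_m_m y hym B hB.1), fun z hz => ?_⟩
  have key : ∀ u ∈ a, ∀ v ∈ a, killingForm ℝ g z ⁅⁅u, B⁆, ⁅v, B⁆⁆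
      = - killingForm ℝ g ⁅z, B⁆ ⁅u, ⁅v, B⁆⁆ := by
    intro u hu v hv
    have h1 : ⁅z, ⁅u, B⁆⁆ = - ⁅⁅z, B⁆, u⁆ := by
      rw [leibniz_lie z u B, hz.2 u hu, zero_lie, zero_add, lie_skew]
    rw [← killing_assoc z, h1, map_neg, LinearMap.neg_apply, killing_assoc]
  have hsymm : ⁅x, ⁅y, B⁆⁆ = ⁅y, ⁅x, B⁆⁆ := by
    rw [leibniz_lie x y B, ha.prop.2 x hx y hy, zero_lie, zero_add]
  have h2 : killingForm ℝ g z ⁅⁅x, B⁆, ⁅y, B⁆⁆ = killingForm ℝ g z ⁅⁅y, B⁆, ⁅x, B⁆⁆ := by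
    rw [key x hx y hy, key y hy x hx, hsymm]
  have h3 : killingForm ℝ g z ⁅⁅y, B⁆, ⁅x, B⁆⁆ = - killingForm ℝ g z ⁅⁅x, B⁆, ⁅y, B⁆⁆ := by
    rw [← lie_skew ⁅y, B⁆ ⁅x, B⁆, map_neg]
  rw [killing_symm]
  linarith

/-- The quadratic term `Φ|_B ∈ p ⊗ Λ²a*`, `Φ|_B (A₁, A₂) = [[A₁, B], [A₂, B]]`, for `B ∈ b`. -/
noncomputable def quadTerm (hD : IsCartanDecomposition g₀ m) (ha : IsMaximalAbelian m a) (B : bSpace m a) :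
    a [⋀^Fin 2]→ₗ[ℝ] pSpace g₀ a :=
  Tableau.twoForm
    (LinearMap.mk₂ ℝ
      (fun x y => ⟨⁅⁅(x : g), (B : g)⁆, ⁅(y : g), (B : g)⁆⁆, lie_lie_mem_pSpace hD ha B.2 x.2 y.2⟩)
      (fun x x' y => Subtype.ext (by simp))
      (fun c x y => Subtype.ext (by simp))
      (fun x y y' => Subtype.ext (by simp))
      (fun c x y => Subtype.ext (by simp)))
    (fun x => Subtype.ext (lie_self _))

/-- The quadratic term as a map `Φ : M = a ⊕ A → C^{0,2}(A)`; it does not depend on the point of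
`a`, and an element `ad_B|_a` of `A` is identified with `B ∈ b`. -/
noncomputable def Phi (hD : IsCartanDecomposition g₀ m) (ha : IsMaximalAbelian m a) :
    a × tableau hD ha → a [⋀^Fin 2]→ₗ[ℝ] pSpace g₀ a :=
  fun q => quadTerm hD ha ((bEquiv hD ha).symm q.2)

end Cartan

/-!
For `x ∈ a`, the invariance of `κ` and its definiteness on `g₀` and on `m` give
`ker ad_x ∩ range ad_x = 0`. As the `ad_x` commute, the kernel of `t ad_x + ad_y` is
`ker ad_x ∩ ker ad_y` for all but finitely many `t`, so an `A ∈ a` for which `ker ad_A` is minimal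
is regular: what commutes with `A` commutes with `a`. Hence evaluation at `A` is injective on the
tableau, and this forces the characters `dim b, 0, …, 0` as well as the injectivity of
`A⁽¹⁾ → A`, `Q ↦ Q(A)`. The injections `ad_A : b → p` and `ad_A : p → b` show that `dim b = dim p`,
so the composition `p → A⁽¹⁾ → A ≃ b`, which is `X ↦ [X, A]`, is bijective, and therefore so are
`p → A⁽¹⁾` and `A⁽¹⁾ → A`.

For the quadratic term, expanding `[B, [C, [x, y]]] = 0` for `x, y ∈ a` shows that the polarization
of `Φ` at `B, C ∈ b` is the Spencer differential of `x ↦ ad_[B, [C, x]]|_a`, so `Φ` takes values in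
the coboundaries. For `Q ∈ A⁽¹⁾`, writing `Q(x) = ad_{C x}|_a`, the terms of the cyclic sum cancel
in pairs because of `[C x, y] = [C y, x]`.
-/

section LinearAlgebra

variable {K V : Type*} [Field K] [AddCommGroup V] [Module K V]

theorem finrank_basis_flag {n : ℕ} (b : Module.Basis (Fin n) K V) (k : Fin (n + 1)) :
    Module.finrank K (b.flag k) = k := by
  have := b.finiteDimensional_of_finite
  induction k using Fin.induction with
  | zero => simp
  | succ k ih =>
    have hk : b k ∉ b.flag k.castSucc := by simp
    rw [b.flag_succ, sup_comm, Submodule.finrank_sup_span_singleton hk, ih, Fin.val_castSucc,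
      Fin.val_succ]

theorem exists_basis_apply_eq {ι : Type*} (b : Module.Basis ι K V) (i : ι) {v : V} (hv : v ≠ 0) :
    ∃ b' : Module.Basis ι K V, b' i = v := by
  let e := LinearEquiv.toSpanNonzeroSingleton K V (b i) (b.ne_zero i)
  obtain ⟨f, hf⟩ := Submodule.exists_linearEquiv_restrict_eq
    (e.symm ≪≫ₗ LinearEquiv.toSpanNonzeroSingleton K V v hv)
  refine ⟨b.map f, ?_⟩
  have hfe : f (e 1) = v := by simpa using (hf (e 1)).symm
  simpa [e] using hfe

variable [FiniteDimensional K V]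

theorem exists_isUnit_smul_add [Infinite K] {T : Module.End K V} (hT : IsUnit T)
    (S : Module.End K V) : ∃ t : K, IsUnit (t • T + S) := by
  obtain ⟨u, rfl⟩ := hT
  obtain ⟨t, ht⟩ := (Module.End.finite_spectrum (-((↑u⁻¹ : Module.End K V) * S))).exists_notMem
  refine ⟨t, ?_⟩
  convert u.isUnit.mul (spectrum.notMem_iff.1 ht) using 1
  simp [mul_add, Algebra.algebraMap_eq_smul_one]

theorem exists_ker_smul_add_le [Infinite K] {T S : Module.End K V} (hTS : Commute T S)
    (hT : Disjoint T.ker T.range) : ∃ t : K, (t • T + S).ker ≤ T.ker ⊓ S.ker := by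
  have hcomm (x : V) : T (S x) = S (T x) := LinearMap.congr_fun hTS.eq x
  have hTrange : ∀ x ∈ T.range, T x ∈ T.range := fun x _ => ⟨x, rfl⟩
  have hSrange : ∀ x ∈ T.range, S x ∈ T.range := by
    rintro _ ⟨y, rfl⟩
    exact ⟨S y, hcomm y⟩
  have hunit : IsUnit (T.restrict hTrange) := by
    rw [LinearMap.isUnit_iff_ker_eq_bot, LinearMap.ker_eq_bot']
    exact fun x hx => Subtype.ext (Submodule.disjoint_def.1 hT x (congrArg Subtype.val hx) x.2)
  obtain ⟨t, ht⟩ := exists_isUnit_smul_add hunit (S.restrict hSrange)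
  refine ⟨t, fun x hx => ?_⟩
  have hx : t • T x + S x = 0 := hx
  -- `T x` lies in the kernel of `t • T + S` again, and in `range T`, where this map is injective.
  have hTx : T x = 0 := by
    have hTx' : t • T (T x) + S (T x) = 0 := by rw [← hcomm, ← map_smul, ← map_add, hx, map_zero]
    rw [LinearMap.isUnit_iff_ker_eq_bot, LinearMap.ker_eq_bot'] at ht
    exact congrArg Subtype.val (ht ⟨T x, x, rfl⟩ (Subtype.ext hTx'))
  refine ⟨hTx, ?_⟩
  rwa [hTx, smul_zero, zero_add] at hx

theorem exists_mem_forall_ker_le [Infinite K] (L : Submodule K (Module.End K V))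
    (hcomm : ∀ T ∈ L, ∀ S ∈ L, Commute T S) (hdisj : ∀ T ∈ L, Disjoint T.ker T.range) :
    ∃ T ∈ L, ∀ S ∈ L, T.ker ≤ S.ker := by
  obtain ⟨T, hT, hmin⟩ := exists_minimalFor_of_wellFoundedLT (· ∈ L) LinearMap.ker ⟨0, L.zero_mem⟩
  refine ⟨T, hT, fun S hS => ?_⟩
  obtain ⟨t, ht⟩ := exists_ker_smul_add_le (hcomm T hT S hS) (hdisj T hT)
  have hker : T.ker ≤ (t • T + S).ker :=
    hmin (L.add_mem (L.smul_mem t hT) hS) (ht.trans inf_le_left)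
  exact hker.trans (ht.trans inf_le_right)

theorem exists_flag_mem (v : V) :
    ∃ F : ℕ → Submodule K V, Monotone F ∧
      (∀ h ≤ Module.finrank K V, Module.finrank K (F h) = h) ∧
      ∀ h, 1 ≤ h → h ≤ Module.finrank K V → v ∈ F h := by
  let n := Module.finrank K V
  obtain ⟨b, hb⟩ : ∃ b : Module.Basis (Fin n) K V, ∀ i : Fin n, (i : ℕ) = 0 → v ∈ K ∙ b i := by
    rcases eq_or_ne v 0 with rfl | hv
    · exact ⟨Module.finBasis K V, fun _ _ => zero_mem _⟩
    · have : Nontrivial V := ⟨v, 0, hv⟩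
      obtain ⟨b, hb⟩ := exists_basis_apply_eq (Module.finBasis K V) ⟨0, Module.finrank_pos⟩ hv
      refine ⟨b, fun i hi => ?_⟩
      rw [show i = ⟨0, Module.finrank_pos⟩ from Fin.ext hi, hb]
      exact Submodule.mem_span_singleton_self v
  refine ⟨fun h => b.flag ⟨min h n, by omega⟩, fun h k hhk => b.flag_mono ?_, fun h hh => ?_,
    fun h h1 hh => ?_⟩
  · exact Fin.mk_le_mk.2 (min_le_min_right n hhk)
  · rw [finrank_basis_flag]
    exact min_eq_left hh
  · refine Submodule.span_le.2 (Set.singleton_subset_iff.2 ?_) (hb ⟨0, h1.trans hh⟩ rfl)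
    exact b.self_mem_flag (Fin.mk_lt_mk.2 (lt_min h1 (h1.trans hh)))

end LinearAlgebra

namespace Tableau

section Algebra

variable {K V W : Type*} [Field K] [AddCommGroup V] [Module K V] [AddCommGroup W] [Module K W]
  {A : Submodule K (V →ₗ[K] W)} {v : V}

theorem kerOn_eq_bot (hv : Set.InjOn (fun Q : V →ₗ[K] W => Q v) A) {U : Submodule K V}
    (hU : v ∈ U) : kerOn A U = ⊥ :=
  (Submodule.eq_bot_iff _).2 fun _ hQ => hv hQ.1 A.zero_mem (hQ.2 v hU)

theorem hasCharacters_of_injOn [FiniteDimensional K V]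
    (hv : Set.InjOn (fun Q : V →ₗ[K] W => Q v) A) :
    HasCharacters A (fun j => if j = 1 then Module.finrank K A else 0) := by
  obtain ⟨F, hmono, hrank, hmem⟩ := exists_flag_mem (K := K) v
  have hzero : ∀ h, 1 ≤ h → h ≤ Module.finrank K V → Module.finrank K (kerOn A (F h)) = 0 := by
    intro h h1 hh
    rw [kerOn_eq_bot hv (hmem h h1 hh), finrank_bot]
  refine ⟨⟨F, hmono, hrank, fun h h1 hh U _ => (hzero h h1 hh).trans_le (Nat.zero_le _)⟩,
    fun G hG j hj hjn => ?_⟩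
  have hGzero : Module.finrank K (kerOn A (G j)) = 0 := by
    have hle := hG.generic j hj hjn (F j) (by rw [hrank j hjn, hG.finrank_eq j hjn])
    rwa [hzero j hj hjn, Nat.le_zero] at hle
  rw [hGzero, add_zero, Finset.sum_ite_eq', if_pos (Finset.mem_Icc.2 ⟨le_rfl, hj⟩)]

/-- Evaluation `A⁽¹⁾ → A`, `Q ↦ Q(v)`, of the first prolongation at a vector. -/
def prolongationEval (A : Submodule K (V →ₗ[K] W)) (v : V) : prolongation A →ₗ[K] A :=
  LinearMap.applyₗ v ∘ₗ (prolongation A).subtype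

theorem prolongationEval_injective (hv : Set.InjOn (fun Q : V →ₗ[K] W => Q v) A) :
    Function.Injective (prolongationEval A v) := by
  refine fun P Q hPQ => Subtype.ext (LinearMap.ext fun x => Subtype.ext ?_)
  refine hv (Subtype.mem _) (Subtype.mem _) ?_
  calc (P.1 x : V →ₗ[K] W) v = (P.1 v : V →ₗ[K] W) x := P.2 x v
    _ = (Q.1 v : V →ₗ[K] W) x := congrArg (fun R : A => (R : V →ₗ[K] W) x) hPQ
    _ = (Q.1 x : V →ₗ[K] W) v := Q.2 v x

theorem isInvolutive_of_injOn [FiniteDimensional K V]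
    (hv : Set.InjOn (fun Q : V →ₗ[K] W => Q v) A)
    (hsurj : Function.Surjective (prolongationEval A v)) : IsInvolutive A := by
  refine ⟨_, hasCharacters_of_injOn hv, ?_⟩
  have hfinrank : Module.finrank K (prolongation A) = Module.finrank K A :=
    (LinearEquiv.ofBijective _ ⟨prolongationEval_injective hv, hsurj⟩).finrank_eq
  simp only [mul_ite, mul_zero, Finset.sum_ite_eq', one_mul, Finset.mem_Icc, le_refl, true_and]
  split_ifs with hV
  · exact hfinrank
  · have hV0 : Module.finrank K V = 0 := by omega
    have : Subsingleton V := Module.finrank_zero_iff.1 hV0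
    exact Module.finrank_zero_of_subsingleton

end Algebra

section Torsion

variable {E F : Type*} [AddCommGroup E] [Module ℝ E] [FiniteDimensional ℝ E]
  [AddCommGroup F] [Module ℝ F] [FiniteDimensional ℝ F]

theorem hasDifferentialAt_bilinear_diag (β : E →ₗ[ℝ] E →ₗ[ℝ] F) (m : E) :
    HasDifferentialAt (fun x => β x x) (β m + β.flip m) m := by
  let bE := (Module.finBasis ℝ E).equivFun
  let bF := (Module.finBasis ℝ F).equivFun
  let γ : (Fin (Module.finrank ℝ E) → ℝ) →L[ℝ] (Fin (Module.finrank ℝ E) → ℝ) →L[ℝ]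
      (Fin (Module.finrank ℝ F) → ℝ) :=
    LinearMap.toContinuousLinearMap (LinearMap.toContinuousLinearMap.toLinearMap ∘ₗ
      (β.compl₁₂ bE.symm.toLinearMap bE.symm.toLinearMap).compr₂ bF.toLinearMap)
  have hγ : ∀ x y, γ x y = bF (β (bE.symm x) (bE.symm y)) := fun _ _ => rfl
  have hderiv := γ.hasFDerivAt_of_bilinear (hasFDerivAt_id (bE m)) (hasFDerivAt_id (bE m))
  unfold HasDifferentialAt
  convert! hderiv using 1
  ext1 x
  change bF (β m (bE.symm x) + β (bE.symm x) m) = γ (bE m) x + γ x (bE m)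
  rw [hγ, hγ, bE.symm_apply_apply, map_add]

end Torsion

end Tableau

namespace Cartan

theorem lie_lie_lie_sub_lie_lie_lie {L : Type*} [LieRing L] {x y : L} (hxy : ⁅x, y⁆ = 0)
    (B C : L) :
    ⁅⁅B, ⁅C, y⁆⁆, x⁆ - ⁅⁅B, ⁅C, x⁆⁆, y⁆ = ⁅⁅B, x⁆, ⁅C, y⁆⁆ + ⁅⁅C, x⁆, ⁅B, y⁆⁆ := by
  have hzero : ⁅B, ⁅C, ⁅x, y⁆⁆⁆ = 0 := by rw [hxy, lie_zero, lie_zero]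
  rw [leibniz_lie C, lie_add, leibniz_lie B, leibniz_lie B x, ← lie_skew x] at hzero
  rw [← sub_eq_zero, ← neg_eq_zero, ← hzero]
  abel

variable {g : Type*} [LieRing g] [LieAlgebra ℝ g] {g₀ m a : Submodule ℝ g}

section Regular

/-- `A ∈ a` is regular in `a` if whatever commutes with `A` commutes with all of `a`, i.e. if the
centralizer of `A` in `g` is as small as possible. -/
structure IsRegular (a : Submodule ℝ g) (A : g) : Prop where
  mem : A ∈ a
  lie_eq_zero : ∀ x : g, ⁅x, A⁆ = 0 → ∀ y ∈ a, ⁅x, y⁆ = 0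

theorem killing_lie_lie (A x y : g) :
    killingForm ℝ g ⁅A, x⁆ ⁅A, y⁆ = -killingForm ℝ g x ⁅A, ⁅A, y⁆⁆ := by
  rw [← lie_skew, map_neg, LinearMap.neg_apply, killing_assoc]

theorem IsCartanDecomposition.lie_m_g₀ (hD : IsCartanDecomposition g₀ m) {x y : g} (hx : x ∈ m)
    (hy : y ∈ g₀) : ⁅x, y⁆ ∈ m := by
  rw [← lie_skew]
  exact neg_mem (hD.lie_g₀_m y hy x hx)

theorem IsCartanDecomposition.lie_eq_zero_of_lie_lie_eq_zero (hD : IsCartanDecomposition g₀ m)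
    {A x : g} (hA : A ∈ m) (hx : ⁅A, ⁅A, x⁆⁆ = 0) : ⁅A, x⁆ = 0 := by
  obtain ⟨u, hu, v, hv, rfl⟩ := Submodule.mem_sup.1 (hD.isCompl.sup_eq_top ▸ Submodule.mem_top :
    x ∈ g₀ ⊔ m)
  have hAu : ⁅A, u⁆ ∈ m := hD.lie_m_g₀ hA hu
  have hAv : ⁅A, v⁆ ∈ g₀ := hD.lie_m_m A hA v hv
  have horth : killingForm ℝ g ⁅A, v⁆ ⁅A, u⁆ = 0 := hD.orthogonal _ hAv _ hAu
  have hnull (w : g) : killingForm ℝ g ⁅A, w⁆ ⁅A, u⁆ + killingForm ℝ g ⁅A, w⁆ ⁅A, v⁆ = 0 := by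
    rw [← map_add, ← lie_add, killing_lie_lie, hx, map_zero, neg_zero]
  have hu0 : ⁅A, u⁆ = 0 := by
    by_contra hne
    have hpos := hD.pos_def _ hAu hne
    linarith [hnull u, killing_symm ⁅A, u⁆ ⁅A, v⁆]
  have hv0 : ⁅A, v⁆ = 0 := by
    by_contra hne
    have hneg := hD.neg_def _ hAv hne
    linarith [hnull v]
  rw [lie_add, hu0, hv0, add_zero]

theorem exists_isRegular [FiniteDimensional ℝ g] (hD : IsCartanDecomposition g₀ m)
    (ha : IsMaximalAbelian m a) : ∃ A, IsRegular a A := by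
  have hcomm : ∀ T ∈ a.map (LieAlgebra.ad ℝ g : g →ₗ[ℝ] Module.End ℝ g),
      ∀ S ∈ a.map (LieAlgebra.ad ℝ g : g →ₗ[ℝ] Module.End ℝ g), Commute T S := by
    rintro _ ⟨x, hx, rfl⟩ _ ⟨y, hy, rfl⟩
    refine LinearMap.ext fun z => ?_
    change ⁅x, ⁅y, z⁆⁆ = ⁅y, ⁅x, z⁆⁆
    rw [leibniz_lie, ha.prop.2 x hx y hy, zero_lie, zero_add]
  have hdisj : ∀ T ∈ a.map (LieAlgebra.ad ℝ g : g →ₗ[ℝ] Module.End ℝ g),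
      Disjoint T.ker T.range := by
    rintro _ ⟨x, hx, rfl⟩
    rw [Submodule.disjoint_def]
    rintro _ hz ⟨z, rfl⟩
    exact hD.lie_eq_zero_of_lie_lie_eq_zero (ha.prop.1 hx) hz
  obtain ⟨_, ⟨A, hA, rfl⟩, hker⟩ := exists_mem_forall_ker_le _ hcomm hdisj
  refine ⟨A, hA, fun x hx y hy => ?_⟩
  have hxA : ⁅A, x⁆ = 0 := by rw [← lie_skew, hx, neg_zero]
  have hyx : ⁅y, x⁆ = 0 := hker _ ⟨y, hy, rfl⟩ hxA
  rw [← lie_skew, hyx, neg_zero]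

end Regular

section Prolongation

theorem bEquiv_apply_apply (hD : IsCartanDecomposition g₀ m) (ha : IsMaximalAbelian m a)
    (B : bSpace m a) (y : a) :
    ((bEquiv hD ha B : a →ₗ[ℝ] pSpace g₀ a) y : g) = ⁅(B : g), (y : g)⁆ := rfl

theorem lie_bEquiv_symm (hD : IsCartanDecomposition g₀ m) (ha : IsMaximalAbelian m a)
    (Q : tableau hD ha) (y : a) :
    ⁅((bEquiv hD ha).symm Q : g), (y : g)⁆ = ((Q : a →ₗ[ℝ] pSpace g₀ a) y : g) := by
  rw [← bEquiv_apply_apply, LinearEquiv.apply_symm_apply]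

theorem eq_zero_of_mem_pSpace (hD : IsCartanDecomposition g₀ m) {X : g} (hX : X ∈ pSpace g₀ a)
    (hXa : ∀ y ∈ a, ⁅X, y⁆ = 0) : X = 0 := by
  by_contra hne
  exact (hD.neg_def X hX.1 hne).ne (hX.2 X ⟨hX.1, hXa⟩)

theorem lie_mem_bSpace (hD : IsCartanDecomposition g₀ m) (ha : IsMaximalAbelian m a) {X y : g}
    (hX : X ∈ g₀) (hy : y ∈ a) : ⁅X, y⁆ ∈ bSpace m a := by
  refine ⟨hD.lie_g₀_m X hX y (ha.prop.1 hy), fun z hz => ?_⟩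
  rw [killing_assoc, ha.prop.2 y hy z hz, map_zero]

/-- The map `p → Hom(a, b)`, `X ↦ ad_X|_a`, the counterpart of `adMap` with the roles of `b` and
`p` interchanged. -/
def adMapP (hD : IsCartanDecomposition g₀ m) (ha : IsMaximalAbelian m a) :
    pSpace g₀ a →ₗ[ℝ] a →ₗ[ℝ] bSpace m a :=
  LinearMap.mk₂ ℝ (fun X y => ⟨⁅(X : g), (y : g)⁆, lie_mem_bSpace hD ha X.2.1 y.2⟩)
    (fun _ _ _ => Subtype.ext (add_lie _ _ _))
    (fun _ _ _ => Subtype.ext (smul_lie _ _ _))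
    (fun _ _ _ => Subtype.ext (lie_add _ _ _))
    (fun _ _ _ => Subtype.ext (lie_smul _ _ _))

theorem lie_lie_comm (ha : IsMaximalAbelian m a) (X : g) {y z : g} (hy : y ∈ a) (hz : z ∈ a) :
    ⁅⁅X, y⁆, z⁆ = ⁅⁅X, z⁆, y⁆ := by
  rw [← sub_eq_zero, lie_lie, ← lie_skew ⁅X, z⁆, ha.prop.2 y hy z hz, lie_zero, zero_sub,
    sub_neg_eq_add, neg_add_cancel]

/-- The map `p → A⁽¹⁾` that sends `X` to `y ↦ ad_[X, y]|_a`. -/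
noncomputable def prolongMap (hD : IsCartanDecomposition g₀ m) (ha : IsMaximalAbelian m a) :
    pSpace g₀ a →ₗ[ℝ] Tableau.prolongation (tableau hD ha) :=
  LinearMap.codRestrict _ (LinearMap.compRight ℝ (bEquiv hD ha).toLinearMap ∘ₗ adMapP hD ha)
    fun X y z => Subtype.ext (lie_lie_comm ha X y.2 z.2)

theorem adMap_flip_injective (hD : IsCartanDecomposition g₀ m) (ha : IsMaximalAbelian m a)
    {A : a} (hA : IsRegular a (A : g)) : Function.Injective ((adMap hD ha).flip A) := by
  rw [injective_iff_map_eq_zero]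
  intro B hB
  have hBa := hA.lie_eq_zero B (congrArg Subtype.val hB)
  exact (injective_iff_map_eq_zero _).1 (adMap_injective hD ha) B
    (LinearMap.ext fun y => Subtype.ext (hBa y y.2))

theorem adMapP_flip_injective (hD : IsCartanDecomposition g₀ m) (ha : IsMaximalAbelian m a)
    {A : a} (hA : IsRegular a (A : g)) : Function.Injective ((adMapP hD ha).flip A) := by
  rw [injective_iff_map_eq_zero]
  intro X hX
  exact Subtype.ext (eq_zero_of_mem_pSpace hD X.2 (hA.lie_eq_zero X (congrArg Subtype.val hX)))

theorem adMapP_flip_bijective [FiniteDimensional ℝ g] (hD : IsCartanDecomposition g₀ m)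
    (ha : IsMaximalAbelian m a) {A : a} (hA : IsRegular a (A : g)) :
    Function.Bijective ((adMapP hD ha).flip A) := by
  have hinj := adMapP_flip_injective hD ha hA
  have hfinrank : Module.finrank ℝ (pSpace g₀ a) = Module.finrank ℝ (bSpace m a) :=
    le_antisymm (LinearMap.finrank_le_finrank_of_injective hinj)
      (LinearMap.finrank_le_finrank_of_injective (adMap_flip_injective hD ha hA))
  exact ⟨hinj, (LinearMap.injective_iff_surjective_of_finrank_eq_finrank hfinrank).1 hinj⟩

theorem injOn_tableau_eval (hD : IsCartanDecomposition g₀ m) (ha : IsMaximalAbelian m a)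
    {A : a} (hA : IsRegular a (A : g)) :
    Set.InjOn (fun Q : a →ₗ[ℝ] pSpace g₀ a => Q A) (tableau hD ha) := by
  rintro _ ⟨B, rfl⟩ _ ⟨C, rfl⟩ hBC
  exact congrArg _ (adMap_flip_injective hD ha hA hBC)

theorem prolongationEval_comp_prolongMap (hD : IsCartanDecomposition g₀ m)
    (ha : IsMaximalAbelian m a) (A : a) :
    Tableau.prolongationEval (tableau hD ha) A ∘ prolongMap hD ha =
      bEquiv hD ha ∘ (adMapP hD ha).flip A := rfl

theorem prolongationEval_bijective [FiniteDimensional ℝ g] (hD : IsCartanDecomposition g₀ m)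
    (ha : IsMaximalAbelian m a) {A : a} (hA : IsRegular a (A : g)) :
    Function.Bijective (Tableau.prolongationEval (tableau hD ha) A) := by
  refine ⟨Tableau.prolongationEval_injective (injOn_tableau_eval hD ha hA),
    Function.Surjective.of_comp (g := prolongMap hD ha) ?_⟩
  rw [prolongationEval_comp_prolongMap]
  exact (bEquiv hD ha).surjective.comp (adMapP_flip_bijective hD ha hA).2

theorem prolongMap_bijective [FiniteDimensional ℝ g] (hD : IsCartanDecomposition g₀ m)
    (ha : IsMaximalAbelian m a) : Function.Bijective (prolongMap hD ha) := by
  obtain ⟨A, hA⟩ := exists_isRegular hD ha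
  lift A to a using hA.mem
  rw [← Function.Bijective.of_comp_iff' (prolongationEval_bijective hD ha hA),
    prolongationEval_comp_prolongMap]
  exact (bEquiv hD ha).bijective.comp (adMapP_flip_bijective hD ha hA)

end Prolongation

section Torsion

theorem lie_mem_pSpace_of_mem_m (hD : IsCartanDecomposition g₀ m) (ha : IsMaximalAbelian m a)
    {x y : g} (hx : x ∈ m) (hy : y ∈ a) : ⁅x, y⁆ ∈ pSpace g₀ a := by
  refine ⟨hD.lie_m_m x hx y (ha.prop.1 hy), fun z hz => ?_⟩
  rw [killing_assoc, ← lie_skew, hz.2 y hy, neg_zero, map_zero]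

/-- The map `m → Hom(a, p)`, `z ↦ ad_z|_a`, extending `adMap` from `b` to `m`. -/
def adMapM (hD : IsCartanDecomposition g₀ m) (ha : IsMaximalAbelian m a) :
    m →ₗ[ℝ] a →ₗ[ℝ] pSpace g₀ a :=
  LinearMap.mk₂ ℝ (fun z y => ⟨⁅(z : g), (y : g)⁆, lie_mem_pSpace_of_mem_m hD ha z.2 y.2⟩)
    (fun _ _ _ => Subtype.ext (add_lie _ _ _))
    (fun _ _ _ => Subtype.ext (smul_lie _ _ _))
    (fun _ _ _ => Subtype.ext (lie_add _ _ _))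
    (fun _ _ _ => Subtype.ext (lie_smul _ _ _))

theorem exists_mem_bSpace_sub_mem [FiniteDimensional ℝ g] (hD : IsCartanDecomposition g₀ m)
    (ham : a ≤ m) {z : g} (hz : z ∈ m) : ∃ B ∈ bSpace m a, z - B ∈ a := by
  have hnondeg : ((killingForm ℝ g).restrict a).Nondegenerate := by
    refine ⟨fun x hx => ?_, fun x hx => ?_⟩ <;>
    · by_contra hne
      exact (hD.pos_def x (ham x.2) fun h => hne (Subtype.ext h)).ne' (hx x)
  have hcompl := LinearMap.BilinForm.isCompl_orthogonal_of_restrict_nondegenerate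
    (fun x y hxy => (killing_symm y x).trans hxy) hnondeg
  obtain ⟨x, hx, B, hB, rfl⟩ := Submodule.mem_sup.1 (hcompl.sup_eq_top ▸ Submodule.mem_top :
    z ∈ a ⊔ (killingForm ℝ g).orthogonal a)
  refine ⟨B, ⟨?_, fun y hy => (killing_symm B y).trans (hB y hy)⟩, by rwa [add_sub_cancel_right]⟩
  exact (Submodule.add_mem_iff_right m (ham hx)).1 hz

theorem adMapM_mem_tableau [FiniteDimensional ℝ g] (hD : IsCartanDecomposition g₀ m)
    (ha : IsMaximalAbelian m a) (z : m) : adMapM hD ha z ∈ tableau hD ha := by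
  obtain ⟨B, hB, hzB⟩ := exists_mem_bSpace_sub_mem hD ha.prop.1 z.2
  refine ⟨⟨B, hB⟩, LinearMap.ext fun y => Subtype.ext (?_ : ⁅B, (y : g)⁆ = ⁅(z : g), (y : g)⁆)⟩
  rw [eq_comm, ← sub_eq_zero, ← sub_lie, ha.prop.2 _ hzB y y.2]

/-- The map `b × b → Hom(a, m)`, `(B, C) ↦ (ad_B ∘ ad_C)|_a`. -/
def adAdMap (hD : IsCartanDecomposition g₀ m) (ha : IsMaximalAbelian m a) :
    bSpace m a →ₗ[ℝ] bSpace m a →ₗ[ℝ] a →ₗ[ℝ] m :=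
  LinearMap.mk₂ ℝ
    (fun B C => (LieAlgebra.ad ℝ g B * LieAlgebra.ad ℝ g C).restrict fun x hx =>
      hD.lie_m_g₀ B.2.1 (hD.lie_m_m C C.2.1 x (ha.prop.1 hx)))
    (fun _ _ _ => LinearMap.ext fun _ => Subtype.ext (add_lie _ _ _))
    (fun _ _ _ => LinearMap.ext fun _ => Subtype.ext (smul_lie _ _ _))
    (fun _ _ _ => LinearMap.ext fun _ => Subtype.ext
      ((congrArg _ (add_lie _ _ _)).trans (lie_add _ _ _)))
    (fun _ _ _ => LinearMap.ext fun _ => Subtype.ext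
      ((congrArg _ (smul_lie _ _ _)).trans (lie_smul _ _ _)))

variable [FiniteDimensional ℝ g]

/-- The polarization `(B, C) ↦ Φ|_{B + C} - Φ|_B - Φ|_C` of the quadratic term, encoded as the
Spencer differential of the map `a → A`, `x ↦ ad_[B, [C, x]]|_a`; this makes it visibly a
coboundary. -/
noncomputable def polarTerm (hD : IsCartanDecomposition g₀ m) (ha : IsMaximalAbelian m a) :
    bSpace m a →ₗ[ℝ] bSpace m a →ₗ[ℝ] a [⋀^Fin 2]→ₗ[ℝ] pSpace g₀ a :=
  (adAdMap hD ha).compr₂ (Tableau.spencerDelta (tableau hD ha) ∘ₗ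
    LinearMap.compRight ℝ ((adMapM hD ha).codRestrict _ (adMapM_mem_tableau hD ha)))

theorem coe_polarTerm (hD : IsCartanDecomposition g₀ m) (ha : IsMaximalAbelian m a)
    (B C : bSpace m a) (v : Fin 2 → a) :
    (polarTerm hD ha B C v : g) = ⁅⁅(B : g), (v 0 : g)⁆, ⁅(C : g), (v 1 : g)⁆⁆ +
      ⁅⁅(C : g), (v 0 : g)⁆, ⁅(B : g), (v 1 : g)⁆⁆ :=
  lie_lie_lie_sub_lie_lie_lie (ha.prop.2 _ (v 0).2 _ (v 1).2) (B : g) C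

theorem polarTerm_comm (hD : IsCartanDecomposition g₀ m) (ha : IsMaximalAbelian m a)
    (B C : bSpace m a) : polarTerm hD ha B C = polarTerm hD ha C B := by
  ext v
  rw [coe_polarTerm, coe_polarTerm, add_comm]

theorem quadTerm_eq_smul_polarTerm (hD : IsCartanDecomposition g₀ m) (ha : IsMaximalAbelian m a)
    (B : bSpace m a) : quadTerm hD ha B = (2⁻¹ : ℝ) • polarTerm hD ha B B := by
  rw [eq_inv_smul_iff₀ two_ne_zero]
  ext v
  have hquad : (quadTerm hD ha B v : g) = ⁅⁅(v 0 : g), (B : g)⁆, ⁅(v 1 : g), (B : g)⁆⁆ := rfl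
  rw [coe_polarTerm, AlternatingMap.smul_apply, Submodule.coe_smul, hquad, ← lie_skew (B : g),
    ← lie_skew (B : g), neg_lie, lie_neg, neg_neg, two_smul]

theorem quadTerm_mem_B02 (hD : IsCartanDecomposition g₀ m) (ha : IsMaximalAbelian m a)
    (B : bSpace m a) : quadTerm hD ha B ∈ Tableau.B02 (tableau hD ha) := by
  rw [quadTerm_eq_smul_polarTerm]
  exact Submodule.smul_mem _ _ ⟨_, rfl⟩

theorem hasDifferentialAt_Phi (hD : IsCartanDecomposition g₀ m) (ha : IsMaximalAbelian m a)
    (q : a × tableau hD ha) :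
    Tableau.HasDifferentialAt (Phi hD ha)
      (polarTerm hD ha ((bEquiv hD ha).symm q.2) ∘ₗ (bEquiv hD ha).symm.toLinearMap ∘ₗ
        LinearMap.snd ℝ a (tableau hD ha)) q := by
  let toB : a × tableau hD ha →ₗ[ℝ] bSpace m a :=
    (bEquiv hD ha).symm.toLinearMap ∘ₗ LinearMap.snd ℝ a (tableau hD ha)
  convert! Tableau.hasDifferentialAt_bilinear_diag
    ((2⁻¹ : ℝ) • (polarTerm hD ha).compl₁₂ toB toB) q using 1
  · exact funext fun x => quadTerm_eq_smul_polarTerm hD ha (toB x)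
  · refine LinearMap.ext fun x => ?_
    change polarTerm hD ha (toB q) (toB x) = (2⁻¹ : ℝ) • polarTerm hD ha (toB q) (toB x) +
      (2⁻¹ : ℝ) • polarTerm hD ha (toB x) (toB q)
    rw [polarTerm_comm hD ha (toB x), ← two_smul ℝ, smul_inv_smul₀ two_ne_zero]

theorem torsionCondition_Phi (hD : IsCartanDecomposition g₀ m) (ha : IsMaximalAbelian m a) :
    Tableau.TorsionCondition (tableau hD ha) (Phi hD ha) := by
  refine fun q => ⟨_, hasDifferentialAt_Phi hD ha q, fun Q hQ A₁ A₂ A₃ => Subtype.ext ?_⟩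
  let B := (bEquiv hD ha).symm q.2
  let C (x : a) : bSpace m a := (bEquiv hD ha).symm (Q x)
  have hC (x y : a) : ⁅(C x : g), (y : g)⁆ = ⁅(C y : g), (x : g)⁆ := by
    rw [lie_bEquiv_symm, lie_bEquiv_symm, hQ]
  change (polarTerm hD ha B (C A₁) ![A₂, A₃] : g) + polarTerm hD ha B (C A₂) ![A₃, A₁] +
    polarTerm hD ha B (C A₃) ![A₁, A₂] = 0
  simp only [coe_polarTerm, Matrix.cons_val_zero, Matrix.cons_val_one]
  rw [hC A₂ A₁, hC A₃ A₁, hC A₃ A₂, ← lie_skew ⁅(B : g), (A₁ : g)⁆,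
    ← lie_skew ⁅(B : g), (A₂ : g)⁆, ← lie_skew ⁅(B : g), (A₃ : g)⁆]
  abel

end Torsion

end Cartan

theorem mainTheorem3 {g : Type*} [LieRing g] [LieAlgebra ℝ g] [FiniteDimensional ℝ g]
    [LieAlgebra.IsSemisimple ℝ g] {g₀ m a : Submodule ℝ g}
    (hD : Cartan.IsCartanDecomposition g₀ m) (ha : Cartan.IsMaximalAbelian m a) :
    Tableau.IsInvolutive (Cartan.tableau hD ha) ∧
    Tableau.HasCharacters (Cartan.tableau hD ha)
      (fun j => if j = 1 then Module.finrank ℝ (Cartan.bSpace m a) else 0) ∧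
    (∃ e : Cartan.pSpace g₀ a ≃ₗ[ℝ] Tableau.prolongation (Cartan.tableau hD ha),
      ∀ (X : Cartan.pSpace g₀ a) (A₁ A₂ : a),
        ((((e X : a →ₗ[ℝ] Cartan.tableau hD ha) A₁ : a →ₗ[ℝ] Cartan.pSpace g₀ a) A₂ :
            Cartan.pSpace g₀ a) : g) = ⁅⁅(X : g), (A₁ : g)⁆, (A₂ : g)⁆) ∧
    (∀ q : a × Cartan.tableau hD ha, Cartan.Phi hD ha q ∈ Tableau.B02 (Cartan.tableau hD ha)) ∧
    Tableau.TorsionCondition (Cartan.tableau hD ha) (Cartan.Phi hD ha) := by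
  obtain ⟨A, hA⟩ := Cartan.exists_isRegular hD ha
  lift A to a using hA.mem
  have hinj := Cartan.injOn_tableau_eval hD ha hA
  refine ⟨Tableau.isInvolutive_of_injOn hinj (Cartan.prolongationEval_bijective hD ha hA).2, ?_,
    ⟨LinearEquiv.ofBijective _ (Cartan.prolongMap_bijective hD ha), fun X A₁ A₂ => rfl⟩,
    fun q => Cartan.quadTerm_mem_B02 hD ha _, Cartan.torsionCondition_Phi hD ha⟩
  rw [(Cartan.bEquiv hD ha).finrank_eq]
  exact Tableau.hasCharacters_of_injOn hinj
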